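/- Let $\Gamma$ be a countable group. Let $\operatorname{p-Ord}(\Gamma)$ be the set of strict partial orders on $\Gamma$ (transitive, irreflexive, antisymmetric binary relations) and $\operatorname{Ord}(\Gamma)\subset\operatorname{p-Ord}(\Gamma)$ the set of strict total orders, both with the subspace topology from $\{0,1\}^{\Gamma\times\Gamma}$, the associated Borel $\sigma$-algebra, and the action of $\Gamma$ given by $x\,(\gamma\cdot{\prec})\,y \iff \gamma^{-1}x\prec\gamma^{-1}y$. Let $\Gamma\curvearrowright(X,\mathcal B,\mu)$ be an ergodic probability-measure-preserving action on a standard Borel probability space such that $\mu$ is not supported on a finite set. Then the following are equivalent: 1. There is a $\Gamma$-invariant Borel probability measure $\nu$ on $\operatorname{Ord}(\Gamma)$ such that $\Gamma\curvearrowright(X,\mathcal B,\mu)$ is measure-theoretically isomorphic to $\Gamma\curvearrowright(\operatorname{Ord}(\Gamma),\nu)$; that is, there is a measure-preserving map $X\to\operatorname{Ord}(\Gamma)$ which is invertible modulo null sets, with measure-preserving inverse, and commutes with the action of each $\gamma \in \Gamma$ almost everywhere. 2. There is a measurable map $\pi:X\to\operatorname{p-Ord}(\Gamma)$ with $\pi(\gamma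 x)=\gamma\cdot\pi(x)$ for all $\gamma\in\Gamma$ and $x\in X$, such that for $\mu$-almost every $x\in X$ the restriction of $\pi(x)$ to the stabilizer $\operatorname{stab}(x)=\{\gamma\in\Gamma:\gamma x=x\}$ is a left-invariant total order on $\operatorname{stab}(x)$. -/

import Mathlib

open MeasureTheory

/-- `p-Ord(Γ)`: the (strict) partial orders on `Γ`, as a subset of the space `{0,1}^(Γ × Γ)` of all
binary relations (in curried form). As a subtype of a product of copies of `Bool`, it carries the
subspace topology of the product topology, and, for countable `Γ`, the corresponding Borel
σ-algebra. -/
def PartialOrders (Γ : Type*) : Set (Γ → Γ → Bool) :=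
  {r | (∀ x y, r x y = true → ¬ r y x = true) ∧ (∀ x, ¬ r x x = true) ∧
    (∀ x y z, r x y = true → r y z = true → r x z = true)}

/-- `Ord(Γ)`: the (strict) total orders on `Γ`. -/
def TotalOrders (Γ : Type*) : Set (Γ → Γ → Bool) :=
  {r | r ∈ PartialOrders Γ ∧ ∀ x y, x ≠ y → r x y = true ∨ r y x = true}

/-- The left action on relations: `x (γ · r) y` if and only if `(γ⁻¹ x) r (γ⁻¹ y)`. -/
def translateRel {Γ : Type*} [Group Γ] (γ : Γ) (r : Γ → Γ → Bool) : Γ → Γ → Bool :=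
  fun x y => r (γ⁻¹ * x) (γ⁻¹ * y)

theorem translateRel_mem_partialOrders {Γ : Type*} [Group Γ] (γ : Γ) {r : Γ → Γ → Bool}
    (hr : r ∈ PartialOrders Γ) : translateRel γ r ∈ PartialOrders Γ :=
  ⟨fun _ _ h => hr.1 _ _ h, fun _ => hr.2.1 _, fun _ _ _ h h' => hr.2.2 _ _ _ h h'⟩

theorem translateRel_mem_totalOrders {Γ : Type*} [Group Γ] (γ : Γ) {r : Γ → Γ → Bool}
    (hr : r ∈ TotalOrders Γ) : translateRel γ r ∈ TotalOrders Γ :=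
  ⟨translateRel_mem_partialOrders γ hr.1,
    fun _ _ hxy => hr.2 _ _ fun h => hxy (mul_left_cancel h)⟩

instance PartialOrders.instMulAction {Γ : Type*} [Group Γ] :
    MulAction Γ (PartialOrders Γ) where
  smul γ r := ⟨translateRel γ r.1, translateRel_mem_partialOrders γ r.2⟩
  one_smul r := Subtype.ext (by
    funext x y
    change r.1 (1⁻¹ * x) (1⁻¹ * y) = r.1 x y
    simp)
  mul_smul γ δ r := Subtype.ext (by
    funext x y
    change r.1 ((γ * δ)⁻¹ * x) ((γ * δ)⁻¹ * y) = r.1 (δ⁻¹ * (γ⁻¹ * x)) (δ⁻¹ * (γ⁻¹ * y))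
    simp [mul_assoc])

instance TotalOrders.instMulAction {Γ : Type*} [Group Γ] :
    MulAction Γ (TotalOrders Γ) where
  smul γ r := ⟨translateRel γ r.1, translateRel_mem_totalOrders γ r.2⟩
  one_smul r := Subtype.ext (by
    funext x y
    change r.1 (1⁻¹ * x) (1⁻¹ * y) = r.1 x y
    simp)
  mul_smul γ δ r := Subtype.ext (by
    funext x y
    change r.1 ((γ * δ)⁻¹ * x) ((γ * δ)⁻¹ * y) = r.1 (δ⁻¹ * (γ⁻¹ * x)) (δ⁻¹ * (γ⁻¹ * y))
    simp [mul_assoc])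

/-- The restriction of a partial order on `Γ` to a subgroup `H`. -/
def PartialOrders.restrict {Γ : Type*} [Group Γ] (r : PartialOrders Γ) (H : Subgroup Γ) :
    PartialOrders H :=
  ⟨fun a b => r.1 a b, fun _ _ h => r.2.1 _ _ h, fun _ => r.2.2.1 _,
    fun _ _ _ h h' => r.2.2.2 _ _ _ h h'⟩

/-- A partial order on `Γ` is a left-invariant total order: it lies in `Ord(Γ)` and is fixed by
the left action of `Γ`. -/
def PartialOrders.IsLeftInvariantTotal {Γ : Type*} [Group Γ] (r : PartialOrders Γ) : Prop :=
  r.1 ∈ TotalOrders Γ ∧ ∀ γ : Γ, γ • r = r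

/-- Measure-theoretic isomorphism of two measure-preserving actions of `Γ`: an invertible
(modulo null sets) measure-preserving map that commutes with the actions almost everywhere. -/
def MeasurablyIsomorphicActions (Γ : Type*) {X Y : Type*} [SMul Γ X] [SMul Γ Y]
    [MeasurableSpace X] [MeasurableSpace Y] (μ : Measure X) (ν : Measure Y) : Prop :=
  ∃ (φ : X → Y) (ψ : Y → X), MeasurePreserving φ μ ν ∧ MeasurePreserving ψ ν μ ∧
    (∀ᵐ x ∂μ, ψ (φ x) = x) ∧ (∀ᵐ y ∂ν, φ (ψ y) = y) ∧
    ∀ γ : Γ, ∀ᵐ x ∂μ, φ (γ • x) = γ • φ x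

/-- An invariant random order on `Γ`: a `Γ`-invariant Borel probability measure on `Ord(Γ)`. -/
structure IsInvariantRandomOrder {Γ : Type*} [Group Γ] (ν : Measure (TotalOrders Γ)) : Prop where
  isProbabilityMeasure : IsProbabilityMeasure ν
  smulInvariantMeasure : SMulInvariantMeasure Γ (TotalOrders Γ) ν

/-! From (1) to (2): an almost equivariant map to total orders becomes strictly equivariant once
replaced by the empty order off an invariant conull set. The stabilizer of `x` then fixes the order
attached to `x`, so the restriction is left-invariant.

From (2) to (1): embed `X` in the line by a Borel injection `e` and order `Γ` at `x` by the values
`e (a⁻¹ • x)`. Ties occur only within cosets of stabilizers, where `π x` breaks them (`orbitRel`).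
The map is equivariant; the point is that it is injective on a conull set
(`exists_conull_le_of_forall_smul_lt_imp_le`). Ergodicity gives nonnegative weights whose averages
along almost every orbit converge to integrals, with no amenability: invariant vectors lie in closed
convex hulls of orbits. If `x` and `y` induce the same order and `e x < e y`, averaging shows that
slightly more than `e x` already bounds as much mass as some `q < e y`. The distribution of `e`
would then be flat just to the right of `e x`, which happens only on a null set. -/

open Filter Topology

/-! ### Ergodic averages without amenability -/

/-- Mean ergodic theorem for isometric group actions on Hilbert spaces: the closed convex hull of
an orbit contains an invariant vector, the projection of the orbit to the invariant vectors. -/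
theorem exists_invariant_mem_closure_convexHull_orbit {Γ H : Type*} [Group Γ]
    [NormedAddCommGroup H] [InnerProductSpace ℝ H] [CompleteSpace H]
    (U : Γ → H →ₗᵢ[ℝ] H) (hU : ∀ g h v, U g (U h v) = U (g * h) v) (v : H) :
    ∃ p ∈ closure (convexHull ℝ (Set.range fun g => U g v)), (∀ g, U g p = p) ∧
      ∀ u, (∀ g, U g u = u) → inner ℝ u p = inner ℝ u v := by
  set C := convexHull ℝ (Set.range fun g => U g v) with hC
  have hconv : Convex ℝ (closure C) := (convex_convexHull ℝ _).closure
  have hne : (closure C).Nonempty :=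
    ⟨U 1 v, subset_closure (subset_convexHull ℝ _ ⟨1, rfl⟩)⟩
  obtain ⟨p, hp, hmin⟩ := exists_norm_eq_iInf_of_complete_convex hne isClosed_closure.isComplete
    hconv 0
  have hmin' : ∀ w ∈ closure C, ‖p‖ ≤ ‖w‖ := by
    intro w hw
    have h := ciInf_le (f := fun w : closure C => ‖(0 : H) - w‖)
      ⟨0, Set.forall_mem_range.2 fun _ => norm_nonneg _⟩ ⟨w, hw⟩
    rw [← hmin] at h
    simpa using h
  have hinv : ∀ g, ∀ w ∈ closure C, U g w ∈ closure C := by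
    intro g
    have h1 : Set.MapsTo (U g) C C := by
      intro w hw
      have : U g w ∈ (U g).toLinearMap '' C := ⟨w, hw, rfl⟩
      rw [hC, LinearMap.image_convexHull] at this
      refine convexHull_mono ?_ this
      rintro _ ⟨_, ⟨h, rfl⟩, rfl⟩
      exact ⟨g * h, (hU g h v).symm⟩
    exact fun w hw => h1.closure (U g).continuous hw
  refine ⟨p, hp, fun g => ?_, fun u hu => ?_⟩
  -- Strict convexity: the midpoint of `p` and `U g p` would be shorter than the minimizer `p`.
  · by_contra hne
    have hlt := norm_combo_lt_of_ne ((U g).norm_map p).le le_rfl hne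
      (show (0 : ℝ) < 1 / 2 by norm_num) (show (0 : ℝ) < 1 / 2 by norm_num) (by norm_num)
    exact absurd (hmin' _ (hconv (hinv g p hp) hp (by norm_num : (0 : ℝ) ≤ 1 / 2)
      (by norm_num : (0 : ℝ) ≤ 1 / 2) (by norm_num))) (not_le.2 hlt)
  · have hsub : closure C ⊆ {w | inner ℝ u w = inner ℝ u v} := by
      refine closure_minimal (convexHull_min ?_ ?_) ?_
      · rintro _ ⟨g, rfl⟩
        change inner ℝ u (U g v) = inner ℝ u v
        conv_lhs => rw [← hu g]
        exact (U g).inner_map_map u v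
      · intro a ha b hb s t _ _ hst
        simp only [Set.mem_ofPred_eq] at ha hb ⊢
        rw [inner_add_right, inner_smul_right, inner_smul_right, ha, hb, ← add_mul, hst, one_mul]
      · exact isClosed_eq (by fun_prop) continuous_const
    exact hsub hp

/-- For an ergodic action, convex combinations of translates of a square integrable function
approximate its integral. -/
theorem exists_average_eLpNorm_sub_integral_le {Γ X E : Type*} [Group Γ] [MeasurableSpace X]
    [MulAction Γ X] [MeasurableConstSMul Γ X] (μ : Measure X) [IsProbabilityMeasure μ]
    [ErgodicSMul Γ X μ] [NormedAddCommGroup E] [InnerProductSpace ℝ E] [CompleteSpace E]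
    [SecondCountableTopology E] {F : X → E} (hF : MemLp F 2 μ) {ε : ℝ} (hε : 0 < ε) :
    ∃ (s : Finset Γ) (w : Γ → ℝ), (∀ g ∈ s, 0 ≤ w g) ∧
      eLpNorm (fun x => ∑ g ∈ s, w g • F (g⁻¹ • x) - ∫ x, F x ∂μ) 2 μ ≤ ENNReal.ofReal ε := by
  borelize E
  have hmp : ∀ g : Γ, MeasurePreserving (fun x : X => g⁻¹ • x) μ μ :=
    fun g => measurePreserving_smul g⁻¹ μ
  let U : Γ → Lp E 2 μ →ₗᵢ[ℝ] Lp E 2 μ := fun g => Lp.compMeasurePreservingₗᵢ ℝ _ (hmp g)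
  have hUcoe : ∀ g f, (U g f : X → E) =ᵐ[μ] fun x => f (g⁻¹ • x) :=
    fun g f => Lp.coeFn_compMeasurePreserving f (hmp g)
  have hU : ∀ g h v, U g (U h v) = U (g * h) v := by
    intro g h v
    apply Lp.ext
    filter_upwards [hUcoe g (U h v), hUcoe (g * h) v,
      (hmp g).quasiMeasurePreserving.ae (hUcoe h v)] with x h1 h2 h3
    rw [h1, h2, h3, mul_inv_rev, mul_smul]
  obtain ⟨p, hp, hpU, hpinner⟩ :=
    exists_invariant_mem_closure_convexHull_orbit U hU (hF.toLp F)
  -- Preimages under an invariant function are null or conull by ergodicity, which forces it to be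
  -- constant.
  obtain ⟨c, hc⟩ : ∃ c, (p : X → E) =ᵐ[μ] Function.const X c := by
    refine exists_eventuallyEq_const_of_forall_separating MeasurableSet fun S hS => ?_
    have hm : MeasurableSet ((p : X → E) ⁻¹' S) := (Lp.stronglyMeasurable p).measurable hS
    have := aeconst_of_forall_preimage_smul_ae_eq Γ (μ := μ) hm.nullMeasurableSet fun g => by
      have h := hUcoe g⁻¹ p
      rw [hpU] at h
      refine (h.mono fun x hx => ?_).set_eq
      simp only [inv_inv] at hx
      simp only [Set.mem_preimage, hx]
    rw [eventuallyConst_set] at this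
    exact this
  have hcint : c = ∫ x, F x ∂μ := by
    -- Constant functions are invariant vectors; pairing with them identifies `c`.
    refine ext_inner_left ℝ fun u => ?_
    have h := hpinner (indicatorConstLp 2 MeasurableSet.univ (measure_ne_top μ _) u) fun g => by
      apply Lp.ext
      have h0 := indicatorConstLp_coeFn (p := 2) (hs := MeasurableSet.univ)
        (hμs := measure_ne_top μ Set.univ) (c := u)
      filter_upwards [hUcoe g (indicatorConstLp 2 MeasurableSet.univ (measure_ne_top μ _) u), h0,
        (hmp g).quasiMeasurePreserving.ae h0] with x h1 h2 h3
      rw [h1, h2, h3]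
      simp
    rw [L2.inner_indicatorConstLp_eq_inner_setIntegral,
      L2.inner_indicatorConstLp_eq_inner_setIntegral, setIntegral_univ, setIntegral_univ,
      integral_congr_ae hc, integral_congr_ae hF.coeFn_toLp] at h
    simpa using h
  obtain ⟨q, hq, hdist⟩ := Metric.mem_closure_iff.1 hp ε hε
  rw [convexHull_range_eq_exists_affineCombination] at hq
  obtain ⟨s, w, hw0, hw1, rfl⟩ := hq
  refine ⟨s, w, hw0, ?_⟩
  rw [s.affineCombination_eq_linear_combination _ _ hw1, dist_comm, dist_eq_norm, Lp.norm_def] at hdist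
  refine le_trans (le_of_eq (eLpNorm_congr_ae ?_))
    ((ENNReal.le_ofReal_iff_toReal_le (Lp.eLpNorm_ne_top _) hε.le).2 hdist.le)
  have hterm : ∀ g : Γ, ∀ᵐ x ∂μ, (w g • U g (hF.toLp F) : Lp E 2 μ) x = w g • F (g⁻¹ • x) := by
    intro g
    filter_upwards [Lp.coeFn_smul (w g) (U g (hF.toLp F)), hUcoe g (hF.toLp F),
      (hmp g).quasiMeasurePreserving.ae hF.coeFn_toLp] with x h1 h2 h3
    rw [h1, Pi.smul_apply, h2, h3]
  have hall : ∀ᵐ x ∂μ, ∀ g ∈ s, (w g • U g (hF.toLp F) : Lp E 2 μ) x = w g • F (g⁻¹ • x) :=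
    (ae_ball_iff s.countable_toSet).2 fun g _ => hterm g
  filter_upwards [Lp.coeFn_sub (∑ g ∈ s, w g • U g (hF.toLp F)) p,
    Lp.coeFn_fun_finsetSum s fun g => w g • U g (hF.toLp F), hc, hall] with x h1 h2 h3 h4
  rw [h1, Pi.sub_apply, h2, h3, Finset.sum_congr rfl h4, hcint]
  rfl

/-- For an ergodic action there is a sequence of weighted averages along which a given sequence
of bounded functions converges almost everywhere to the integrals. -/
theorem exists_averages_ae_tendsto_integral {Γ X : Type*} [Group Γ] [MeasurableSpace X]
    [MulAction Γ X] [MeasurableConstSMul Γ X] (μ : Measure X) [IsProbabilityMeasure μ]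
    [ErgodicSMul Γ X μ] (f : ℕ → X → ℝ) (hf : ∀ k, Measurable (f k)) {C : ℝ}
    (hC : ∀ k x, ‖f k x‖ ≤ C) :
    ∃ (s : ℕ → Finset Γ) (w : ℕ → Γ → ℝ), (∀ n, ∀ g ∈ s n, 0 ≤ w n g) ∧
      ∀ᵐ x ∂μ, ∀ k, Tendsto (fun n => ∑ g ∈ s n, w n g * f k (g⁻¹ • x)) atTop
        (𝓝 (∫ x, f k x ∂μ)) := by
  -- The first `n` functions are bundled into one vector, so that the same weights serve them all.
  let F : (n : ℕ) → X → EuclideanSpace ℝ (Fin n) := fun n x => WithLp.toLp 2 fun i => f i x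
  have hFm : ∀ n, Measurable (F n) := fun n =>
    (WithLp.measurable_toLp 2 (Fin n → ℝ)).comp (measurable_pi_lambda _ fun i => hf i)
  have hF : ∀ n, MemLp (F n) 2 μ := by
    intro n
    have hi : ∀ i : Fin n, MemLp (fun x => (F n x) i) 2 μ := fun i =>
      MemLp.of_bound (hf i).aestronglyMeasurable C (.of_forall fun x => hC i x)
    exact memLp_piLp_iff.2 hi
  have hε : ∀ n : ℕ, (0 : ℝ) < (1 / 2) ^ n := fun n => by positivity
  choose s w hw hsw using fun n =>
    exists_average_eLpNorm_sub_integral_le (Γ := Γ) μ (hF n) (hε n)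
  refine ⟨s, w, hw, ?_⟩
  set D : (n : ℕ) → X → EuclideanSpace ℝ (Fin n) :=
    fun n x => ∑ g ∈ s n, w n g • F n (g⁻¹ • x) - ∫ x, F n x ∂μ with hD
  have hDm : ∀ n, Measurable (D n) := fun n =>
    (Finset.measurable_fun_sum _ fun g _ =>
      ((hFm n).comp (measurable_const_smul g⁻¹)).const_smul (w n g)).sub_const _
  have hD1 : ∀ n, ∫⁻ x, ‖D n x‖ₑ ∂μ ≤ ENNReal.ofReal ((1 / 2) ^ n) := fun n => by
    rw [← eLpNorm_one_eq_lintegral_enorm]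
    exact (eLpNorm_le_eLpNorm_of_exponent_le (by norm_num)
      (hDm n).aestronglyMeasurable).trans (hsw n)
  -- The errors have summable `L¹` norms, so their sum is finite, and they tend to zero, almost
  -- everywhere.
  have hsum : ∫⁻ x, ∑' n, ‖D n x‖ₑ ∂μ ≠ ⊤ := by
    rw [lintegral_tsum fun n => (hDm n).enorm.aemeasurable]
    refine ne_top_of_le_ne_top ?_ (ENNReal.tsum_le_tsum hD1)
    rw [← ENNReal.ofReal_tsum_of_nonneg (fun n => (hε n).le) summable_geometric_two]
    exact ENNReal.ofReal_ne_top
  filter_upwards [ae_lt_top (Measurable.tsum fun n => (hDm n).enorm) hsum] with x hx k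
  have h0 : Tendsto (fun n => ‖D n x‖) atTop (𝓝 0) := by
    have := (ENNReal.tendsto_toReal ENNReal.zero_ne_top).comp
      (ENNReal.tendsto_atTop_zero_of_tsum_ne_top hx.ne)
    simpa [Function.comp_def] using this
  rw [tendsto_iff_norm_sub_tendsto_zero]
  refine tendsto_of_tendsto_of_tendsto_of_le_of_le' tendsto_const_nhds h0
    (.of_forall fun _ => norm_nonneg _) ?_
  filter_upwards [eventually_gt_atTop k] with n hn
  refine le_trans (le_of_eq ?_) (PiLp.norm_apply_le (D n x) ⟨k, hn⟩)
  have hint : (∫ x, F n x ∂μ) ⟨k, hn⟩ = ∫ x, f k x ∂μ :=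
    ((EuclideanSpace.proj (𝕜 := ℝ) (⟨k, hn⟩ : Fin n)).integral_comp_comm
      ((hF n).integrable (by norm_num))).symm
  simp [hD, hint, F]

/-! ### Atomless measures and recovery of a point from its order -/

/-- An ergodic probability measure that is not carried by a finite set has no atoms. -/
theorem nullSingletonClass_of_ergodicSMul {Γ X : Type*} [Group Γ] [Countable Γ] [MeasurableSpace X]
    [MeasurableSingletonClass X] [MulAction Γ X] [MeasurableConstSMul Γ X] (μ : Measure X)
    [IsProbabilityMeasure μ] [ErgodicSMul Γ X μ] (hμ : ∀ S : Set X, S.Finite → μ Sᶜ ≠ 0) :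
    NullSingletonClass μ := by
  refine ⟨fun x => by_contra fun hx => ?_⟩
  have hcount : (MulAction.orbit Γ x).Countable := Set.countable_range _
  have hconst := aeconst_of_forall_preimage_smul_ae_eq Γ (μ := μ)
    hcount.measurableSet.nullMeasurableSet fun g => by
      rw [Set.preimage_smul, MulAction.smul_orbit]; rfl
  rw [eventuallyConst_set] at hconst
  rcases hconst with h | h
  -- All points of the orbit have the mass of `x`, so an infinite orbit would have infinite measure.
  · refine hμ (MulAction.orbit Γ x) ?_ h
    by_contra hinf
    have : Infinite (MulAction.orbit Γ x) := Set.infinite_coe_iff.2 hinf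
    have hpt : ∀ y : MulAction.orbit Γ x, μ {(y : X)} = μ {x} := by
      rintro ⟨_, g, rfl⟩
      change μ {g • x} = _
      rw [← Set.smul_set_singleton, measure_smul]
    have hsum := measure_biUnion (μ := μ) hcount (f := fun y => {y})
      (fun a _ b _ hab => Set.disjoint_singleton.2 hab) fun _ _ => measurableSet_singleton _
    simp only [hpt] at hsum
    rw [ENNReal.tsum_const_eq_top_of_ne_zero hx] at hsum
    exact measure_ne_top μ _ hsum
  · refine hx (measure_mono_null ?_ h)
    rintro _ rfl
    simp

/-- Almost every point of an atomless measure on the line is approached from the right by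
the support of the measure. -/
theorem ae_forall_rat_exists_rat_measure_Ioc_ne_zero (ρ : Measure ℝ) [NullSingletonClass ρ] :
    ∀ᵐ t : ℝ ∂ρ, ∀ q : ℚ, t < (q : ℝ) → ∃ p : ℚ, t < (p : ℝ) ∧ ρ (Set.Ioc (p : ℝ) q) ≠ 0 := by
  refine ae_all_iff.2 fun q => ?_
  have hnull : ∀ p : ℚ, ∀ᵐ t ∂ρ, ρ (Set.Ioc (p : ℝ) q) = 0 → t ∉ Set.Ioc (p : ℝ) q := by
    intro p
    by_cases h : ρ (Set.Ioc (p : ℝ) q) = 0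
    · filter_upwards [measure_eq_zero_iff_ae_notMem.1 h] with t ht _ using ht
    · exact .of_forall fun t h' => absurd h' h
  set N : Set ℝ := {t | t < q ∧ (∀ p : ℚ, t < p → ρ (Set.Ioc (p : ℝ) q) = 0) ∧
    ∀ p : ℚ, ρ (Set.Ioc (p : ℝ) q) = 0 → t ∉ Set.Ioc (p : ℝ) q} with hN
  -- For `a < b` in `N`, a rational `p` between them gives a null interval `(p, q]` containing `b`,
  -- which `N` forbids.
  have hsub : N.Subsingleton := by
    have key : ∀ a ∈ N, ∀ b ∈ N, ¬ a < b := by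
      intro a ha b hb hab
      obtain ⟨p, hap, hpb⟩ := exists_rat_btwn hab
      exact hb.2.2 p (ha.2.1 p hap) ⟨hpb, hb.1.le⟩
    exact fun a ha b hb => le_antisymm (not_lt.1 (key b hb a ha)) (not_lt.1 (key a ha b hb))
  filter_upwards [ae_all_iff.2 hnull, measure_eq_zero_iff_ae_notMem.1 (hsub.measure_zero ρ)]
    with t h1 h2 htq
  by_contra! h
  exact h2 ⟨htq, h, h1⟩

/-- In an atomless ergodic system, the position of a point with respect to a linear order
is determined, almost everywhere, by the set of group elements that move it downwards. -/
theorem exists_conull_le_of_forall_smul_lt_imp_le {Γ X : Type*} [Group Γ] [MeasurableSpace X]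
    [MulAction Γ X] [MeasurableConstSMul Γ X] (μ : Measure X) [IsProbabilityMeasure μ]
    [ErgodicSMul Γ X μ] [NullSingletonClass μ] {e : X → ℝ} (he : MeasurableEmbedding e) :
    ∃ S ∈ ae μ, MeasurableSet S ∧ ∀ x ∈ S, ∀ y ∈ S,
      (∀ g : Γ, e (g⁻¹ • y) < e y → e (g⁻¹ • x) ≤ e x) → e y ≤ e x := by
  set ρ := μ.map e with hρ
  have : IsProbabilityMeasure ρ := Measure.isProbabilityMeasure_map he.measurable.aemeasurable
  have : NullSingletonClass ρ := ⟨fun t => by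
    rw [hρ, he.map_apply]
    exact (Set.subsingleton_singleton.preimage he.injective).measure_zero μ⟩
  obtain ⟨u, hu⟩ := exists_surjective_nat ℚ
  have hm : ∀ q : ℚ, MeasurableSet {x | e x ≤ q} := fun q =>
    measurableSet_le he.measurable measurable_const
  obtain ⟨s, w, hw, hlim⟩ := exists_averages_ae_tendsto_integral (Γ := Γ) μ
    (fun k => {x | e x ≤ u k}.indicator 1) (fun k => measurable_one.indicator (hm _)) (C := 1)
    (fun k x => by
      by_cases h : e x ≤ u k <;> simp [Set.indicator, h])
  obtain ⟨S, hS, hSm, hSp⟩ := (hlim.and (ae_of_ae_map he.measurable.aemeasurable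
    (ae_forall_rat_exists_rat_measure_Ioc_ne_zero ρ))).exists_measurable_mem
  refine ⟨S, hS, hSm, fun x hx y hy hxy => ?_⟩
  by_contra! hlt
  obtain ⟨q, hxq, hqy⟩ := exists_rat_btwn hlt
  obtain ⟨p, hxp, hpq⟩ := (hSp x hx).2 q hxq
  obtain ⟨i, rfl⟩ := hu p
  obtain ⟨j, rfl⟩ := hu q
  -- With `p = u i` and `q = u j`, each translate putting `y` below `q < e y` puts `x` at most at `e
  -- x < p`; the averages compare termwise.
  have hle := le_of_tendsto_of_tendsto' ((hSp y hy).1 j) ((hSp x hx).1 i) fun n =>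
    Finset.sum_le_sum fun g hg => mul_le_mul_of_nonneg_left (by
      by_cases h : e (g⁻¹ • y) ≤ u j
      · have : e (g⁻¹ • x) ≤ u i := (hxy g (h.trans_lt hqy)).trans hxp.le
        simp [Set.indicator, h, this]
      · simp only [Set.indicator, Set.mem_ofPred_eq, h, if_false]
        split_ifs <;> simp) (hw n g hg)
  rw [integral_indicator_one (hm _), integral_indicator_one (hm _)] at hle
  have hcdf : ∀ k, μ.real {x | e x ≤ u k} = ρ.real (Set.Iic (u k : ℝ)) := fun k => by
    rw [measureReal_def, measureReal_def, hρ, he.map_apply]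
    rfl
  rw [hcdf, hcdf] at hle
  refine hpq ?_
  rcases le_total (u i : ℝ) (u j) with hij | hij
  · rw [← measureReal_eq_zero_iff, ← Set.Iic_sdiff_Iic,
      measureReal_sdiff (Set.Iic_subset_Iic.2 hij) measurableSet_Iic]
    exact le_antisymm (by linarith) (sub_nonneg.2 (measureReal_mono (Set.Iic_subset_Iic.2 hij)))
  · rw [Set.Ioc_eq_empty (not_lt.2 hij), measure_empty]

/-! ### Orders on the group read off from orbits -/

/-- The relation on `Γ` induced at `x` by a real-valued function on the orbit of `x`, where ties
are broken by the relation `r`. -/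
noncomputable def orbitRel {Γ X : Type*} [Group Γ] [MulAction Γ X] (e : X → ℝ)
    (r : Γ → Γ → Bool) (x : X) : Γ → Γ → Bool :=
  open Classical in
  fun a b => decide (e (a⁻¹ • x) < e (b⁻¹ • x)) || (decide (a⁻¹ • x = b⁻¹ • x) && r a b)

theorem orbitRel_eq_true_iff {Γ X : Type*} [Group Γ] [MulAction Γ X] {e : X → ℝ}
    {r : Γ → Γ → Bool} {x : X} {a b : Γ} : orbitRel e r x a b = true ↔
      e (a⁻¹ • x) < e (b⁻¹ • x) ∨ a⁻¹ • x = b⁻¹ • x ∧ r a b = true := by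
  simp [orbitRel]

theorem orbitRel_mem_partialOrders {Γ X : Type*} [Group Γ] [MulAction Γ X] (e : X → ℝ)
    {r : Γ → Γ → Bool} (hr : r ∈ PartialOrders Γ) (x : X) :
    orbitRel e r x ∈ PartialOrders Γ := by
  refine ⟨fun a b h h' => ?_, fun a h => ?_, fun a b c h h' => ?_⟩
  · rw [orbitRel_eq_true_iff] at h h'
    rcases h with h | ⟨h, k⟩ <;> rcases h' with h' | ⟨h', k'⟩
    · exact lt_asymm h h'
    · exact (h'.symm ▸ h).false
    · exact (h.symm ▸ h').false
    · exact hr.1 _ _ k k'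
  · rw [orbitRel_eq_true_iff] at h
    rcases h with h | h
    · exact h.false
    · exact hr.2.1 _ h.2
  · rw [orbitRel_eq_true_iff] at h h' ⊢
    rcases h with h | ⟨h, k⟩ <;> rcases h' with h' | ⟨h', k'⟩
    · exact .inl (h.trans h')
    · exact .inl (h' ▸ h)
    · exact .inl (h ▸ h')
    · exact .inr ⟨h.trans h', hr.2.2 _ _ _ k k'⟩

theorem orbitRel_mem_totalOrders {Γ X : Type*} [Group Γ] [MulAction Γ X] {e : X → ℝ}
    (he : Function.Injective e) {r : Γ → Γ → Bool} (hr : r ∈ PartialOrders Γ) {x : X}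
    (htot : ∀ a b : Γ, a ≠ b → a⁻¹ • x = b⁻¹ • x → r a b = true ∨ r b a = true) :
    orbitRel e r x ∈ TotalOrders Γ := by
  refine ⟨orbitRel_mem_partialOrders e hr x, fun a b hab => ?_⟩
  rw [orbitRel_eq_true_iff, orbitRel_eq_true_iff]
  rcases lt_trichotomy (e (a⁻¹ • x)) (e (b⁻¹ • x)) with h | h | h
  · exact .inl (.inl h)
  · have h' := he h
    rcases htot a b hab h' with k | k
    · exact .inl (.inr ⟨h', k⟩)
    · exact .inr (.inr ⟨h'.symm, k⟩)
  · exact .inr (.inl h)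

/-- The inverses in `orbitRel` make this work: `a⁻¹ • γ • x = (γ⁻¹ * a)⁻¹ • x`. -/
theorem orbitRel_smul {Γ X : Type*} [Group Γ] [MulAction Γ X] (e : X → ℝ)
    (r : Γ → Γ → Bool) (γ : Γ) (x : X) :
    orbitRel e (translateRel γ r) (γ • x) = translateRel γ (orbitRel e r x) := by
  funext a b
  change orbitRel e _ _ a b = orbitRel e r x _ _
  rw [Bool.eq_iff_iff, orbitRel_eq_true_iff, orbitRel_eq_true_iff]
  simp [translateRel, mul_smul]

theorem measurable_orbitRel {Γ X : Type*} [Group Γ] [MulAction Γ X] [MeasurableSpace X]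
    [MeasurableConstSMul Γ X] {e : X → ℝ} (he : MeasurableEmbedding e) {r : X → Γ → Γ → Bool}
    (hr : Measurable r) : Measurable fun x => orbitRel e (r x) x := by
  refine measurable_pi_lambda _ fun a => measurable_pi_lambda _ fun b => measurable_to_bool ?_
  have hrab : Measurable fun x => r x a b :=
    (measurable_pi_apply b).comp ((measurable_pi_apply a).comp hr)
  have hea : ∀ a : Γ, Measurable fun x : X => e (a⁻¹ • x) := fun a =>
    he.measurable.comp (measurable_const_smul a⁻¹)
  have : (fun x => orbitRel e (r x) x a b) ⁻¹' {true} = {x | e (a⁻¹ • x) < e (b⁻¹ • x)} ∪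
      ({x | e (a⁻¹ • x) = e (b⁻¹ • x)} ∩ (fun x => r x a b) ⁻¹' {true}) := by
    ext x
    simp [orbitRel_eq_true_iff, he.injective.eq_iff]
  rw [this]
  exact (measurableSet_lt (hea a) (hea b)).union
    ((measurableSet_eq_fun (hea a) (hea b)).inter (hrab (measurableSet_singleton _)))

theorem measurableSet_totalOrders (Γ : Type*) [Countable Γ] : MeasurableSet (TotalOrders Γ) := by
  have hT : ∀ x y, Measurable fun r : Γ → Γ → Bool => r x y = true := by
    intro x y
    have h : Measurable fun r : Γ → Γ → Bool => r x y :=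
      (measurable_pi_apply y).comp (measurable_pi_apply x)
    exact measurableSet_setOfPred.1 (h (measurableSet_singleton true))
  have : TotalOrders Γ = {r | ((∀ x y, r x y = true → ¬ r y x = true) ∧ (∀ x, ¬ r x x = true) ∧
    (∀ x y z, r x y = true → r y z = true → r x z = true)) ∧
      ∀ x y, x ≠ y → r x y = true ∨ r y x = true} := rfl
  rw [this]
  refine measurableSet_setOfPred.2 (((Measurable.and ?_ (.and ?_ ?_))).and ?_)
  · exact .forall fun x => .forall fun y => (hT x y).imp (hT y x).not
  · exact .forall fun x => (hT x x).not
  · exact .forall fun x => .forall fun y => .forall fun z => (hT x y).imp ((hT y z).imp (hT x z))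
  · exact .forall fun x => .forall fun y => measurable_const.imp ((hT x y).or (hT y x))

instance TotalOrders.nonempty_of_countable (Γ : Type*) [Countable Γ] : Nonempty (TotalOrders Γ) := by
  obtain ⟨f, hf⟩ := exists_injective_nat Γ
  refine ⟨⟨fun a b => decide (f a < f b), ⟨?_, ?_, ?_⟩, ?_⟩⟩
  · intro x y
    simpa using le_of_lt
  · simp
  · intro x y z
    simpa using lt_trans
  · intro x y hxy
    simpa using lt_or_gt_of_ne (hf.ne hxy)

instance TotalOrders.instMeasurableConstSMul (Γ : Type*) [Group Γ] :
    MeasurableConstSMul Γ (TotalOrders Γ) where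
  measurable_const_smul γ := by
    refine Measurable.subtype_mk (measurable_pi_lambda _ fun a => measurable_pi_lambda _ fun b => ?_)
    exact (measurable_pi_apply _).comp ((measurable_pi_apply _).comp measurable_subtype_coe)

/-! ### Passing between maps to orders and isomorphisms -/

/-- An injective almost everywhere equivariant map to the space of total orders is an isomorphism
of an invariant measure with an invariant random order. -/
theorem exists_isInvariantRandomOrder_of_injOn {Γ X : Type*} [Group Γ] [Countable Γ]
    [MeasurableSpace X] [StandardBorelSpace X] [MulAction Γ X] [MeasurableConstSMul Γ X]
    (μ : Measure X) [IsProbabilityMeasure μ] [SMulInvariantMeasure Γ X μ]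
    {φ : X → TotalOrders Γ} (hφ : Measurable φ) {S : Set X} (hS : S ∈ ae μ)
    (hSm : MeasurableSet S) (hinj : Set.InjOn φ S)
    (hequiv : ∀ γ : Γ, ∀ᵐ x ∂μ, φ (γ • x) = γ • φ x) :
    ∃ ν : Measure (TotalOrders Γ), IsInvariantRandomOrder ν ∧
      MeasurablyIsomorphicActions Γ μ ν := by
  have hX : Nonempty X := by
    by_contra h
    rw [not_nonempty_iff] at h
    have := measure_univ (μ := μ)
    simp [Measure.eq_zero_of_isEmpty μ] at this
  have := hSm.standardBorel
  -- Lusin–Souslin: injectivity on a standard Borel space yields a measurable inverse.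
  have hemb : MeasurableEmbedding fun x : S => φ x :=
    (hφ.comp measurable_subtype_coe).measurableEmbedding (Set.injOn_iff_injective.1 hinj)
  obtain ⟨ψ, hψ, hψφ⟩ := hemb.exists_measurable_extend (g := ((↑) : S → X))
    measurable_subtype_coe fun _ => hX
  have hleft : ∀ x ∈ S, ψ (φ x) = x := fun x hx => congr_fun hψφ ⟨x, hx⟩
  have hleft' : ∀ᵐ x ∂μ, ψ (φ x) = x := mem_of_superset hS hleft
  refine ⟨μ.map φ, ⟨Measure.isProbabilityMeasure_map hφ.aemeasurable, ⟨fun γ s hs => ?_⟩⟩,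
    φ, ψ, ⟨hφ, rfl⟩, ⟨hψ, ?_⟩, hleft', ?_, hequiv⟩
  · rw [Measure.map_apply hφ (measurable_const_smul γ hs), Measure.map_apply hφ hs,
      ← measure_preimage_smul μ γ (φ ⁻¹' s)]
    refine measure_congr ((hequiv γ).mono fun x hx => ?_).set_eq
    simp only [Set.mem_preimage, hx]
  · rw [Measure.map_map hψ hφ]
    exact (Measure.map_congr hleft').trans Measure.map_id
  · have hm : MeasurableSet (φ '' S) := hSm.image_of_measurable_injOn hφ hinj
    have : ∀ᵐ y ∂μ.map φ, y ∈ φ '' S :=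
      (ae_map_iff hφ.aemeasurable hm).2 (mem_of_superset hS fun x hx => ⟨x, hx, rfl⟩)
    refine this.mono ?_
    rintro _ ⟨x, hx, rfl⟩
    rw [hleft x hx]

/-- A measurable almost everywhere equivariant map to the total orders agrees almost everywhere
with an equivariant map to the partial orders. -/
theorem exists_equivariant_partialOrders {Γ X : Type*} [Group Γ] [Countable Γ]
    [MeasurableSpace X] [MulAction Γ X] [MeasurableConstSMul Γ X] (μ : Measure X)
    [SMulInvariantMeasure Γ X μ] {φ : X → TotalOrders Γ} (hφ : Measurable φ)
    (hequiv : ∀ γ : Γ, ∀ᵐ x ∂μ, φ (γ • x) = γ • φ x) :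
    ∃ π : X → PartialOrders Γ, Measurable π ∧ (∀ (γ : Γ) (x : X), π (γ • x) = γ • π x) ∧
      ∀ᵐ x ∂μ, (π x).1 = (φ x).1 := by
  classical
  obtain ⟨T, hT, hTm, hTφ⟩ := (ae_all_iff.2 hequiv).exists_measurable_mem
  -- Requiring the whole orbit to lie in `T` makes the good set exactly invariant.
  let S : Set X := {x | ∀ δ : Γ, δ • x ∈ T}
  have hSm : MeasurableSet S :=
    measurableSet_setOfPred.2 (Measurable.forall fun δ => measurableSet_setOfPred.1
      (measurable_const_smul δ hTm))
  have hS : ∀ᵐ x ∂μ, x ∈ S := ae_all_iff.2 fun δ => tendsto_smul_ae μ δ hT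
  have hST : ∀ x ∈ S, x ∈ T := fun x hx => by simpa using hx 1
  have hSγ : ∀ (γ : Γ) x, γ • x ∈ S ↔ x ∈ S := fun γ x =>
    ⟨fun h δ => by simpa [smul_smul] using h (δ * γ⁻¹), fun h δ => by
      simpa [smul_smul] using h (δ * γ)⟩
  -- The empty order is fixed by `Γ`, so equivariance survives off `S`.
  let o : PartialOrders Γ := ⟨fun _ _ => false, by simp [PartialOrders]⟩
  have hφp : ∀ x, (φ x).1 ∈ PartialOrders Γ := fun x => (φ x).2.1
  refine ⟨fun x => if x ∈ S then ⟨(φ x).1, hφp x⟩ else o, ?_, fun γ x => ?_, ?_⟩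
  · exact Measurable.ite hSm (measurable_subtype_coe.comp hφ).subtype_mk measurable_const
  · beta_reduce
    by_cases hx : x ∈ S
    · rw [if_pos hx, if_pos ((hSγ γ x).2 hx)]
      refine Subtype.ext ?_
      change (φ (γ • x)).1 = (γ • φ x).1
      rw [hTφ x (hST x hx)]
    · rw [if_neg hx, if_neg (mt (hSγ γ x).1 hx)]
      rfl
  · filter_upwards [hS] with x hx
    rw [if_pos hx]

theorem PartialOrders.isLeftInvariantTotal_restrict_stabilizer {Γ X : Type*} [Group Γ]
    [MulAction Γ X] {π : X → PartialOrders Γ} (hπ : ∀ (γ : Γ) (x : X), π (γ • x) = γ • π x)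
    {x : X} (hx : (π x).1 ∈ TotalOrders Γ) :
    PartialOrders.IsLeftInvariantTotal
      (PartialOrders.restrict (π x) (MulAction.stabilizer Γ x)) := by
  refine ⟨⟨(PartialOrders.restrict (π x) _).2, fun a b hab => hx.2 a b (Subtype.coe_ne_coe.2 hab)⟩, fun γ => ?_⟩
  refine Subtype.ext (funext fun a => funext fun b => ?_)
  have h : π x = (γ : Γ) • π x := by
    rw [← hπ, MulAction.mem_stabilizer_iff.1 γ.2]
  exact (congr_fun (congr_fun (congr_arg Subtype.val h) a) b).symm

/-- The element `a⁻¹ * b` stabilizes `a⁻¹ • x`, so it is comparable with `1` there; translating by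
`a` compares `b` with `a` at `x`. -/
theorem PartialOrders.total_of_isLeftInvariantTotal_restrict {Γ X : Type*} [Group Γ]
    [MulAction Γ X] {π : X → PartialOrders Γ} (hπ : ∀ (γ : Γ) (x : X), π (γ • x) = γ • π x)
    {x : X} {a b : Γ}
    (h : PartialOrders.IsLeftInvariantTotal
      (PartialOrders.restrict (π (a⁻¹ • x)) (MulAction.stabilizer Γ (a⁻¹ • x))))
    (hab : a ≠ b) (hx : a⁻¹ • x = b⁻¹ • x) : (π x).1 a b = true ∨ (π x).1 b a = true := by
  have hmem : a⁻¹ * b ∈ MulAction.stabilizer Γ (a⁻¹ • x) := by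
    rw [MulAction.mem_stabilizer_iff]
    conv_lhs => rw [hx]
    simp [smul_smul]
  have := h.1.2 1 ⟨a⁻¹ * b, hmem⟩ fun h1 => hab (by
    have := congr_arg Subtype.val h1
    exact (inv_mul_eq_one.1 this.symm))
  rw [hπ] at this
  change (π x).1 (a⁻¹⁻¹ * 1) (a⁻¹⁻¹ * (a⁻¹ * b)) = true ∨
    (π x).1 (a⁻¹⁻¹ * (a⁻¹ * b)) (a⁻¹⁻¹ * 1) = true at this
  simpa using this

/-! ### The equivalence -/

theorem mainTheorem2 {Γ : Type*} [Group Γ] [Countable Γ]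
    {X : Type*} [MeasurableSpace X] [StandardBorelSpace X]
    [MulAction Γ X] [MeasurableConstSMul Γ X]
    (μ : Measure X) [IsProbabilityMeasure μ] [ErgodicSMul Γ X μ]
    (hμ : ∀ S : Set X, S.Finite → μ Sᶜ ≠ 0) :
    (∃ ν : Measure (TotalOrders Γ), IsInvariantRandomOrder ν ∧
        MeasurablyIsomorphicActions Γ μ ν) ↔
      ∃ π : X → PartialOrders Γ, Measurable π ∧ (∀ (γ : Γ) (x : X), π (γ • x) = γ • π x) ∧
        ∀ᵐ x ∂μ, PartialOrders.IsLeftInvariantTotal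
          (PartialOrders.restrict (π x) (MulAction.stabilizer Γ x)) := by
  classical
  constructor
  · rintro ⟨ν, -, φ, ψ, hφ, -, -, -, hequiv⟩
    obtain ⟨π, hπm, hπ, hπφ⟩ := exists_equivariant_partialOrders μ hφ.measurable hequiv
    refine ⟨π, hπm, hπ, hπφ.mono fun x hx => ?_⟩
    exact PartialOrders.isLeftInvariantTotal_restrict_stabilizer hπ (hx ▸ (φ x).2)
  · rintro ⟨π, hπm, hπ, hπs⟩
    have := nullSingletonClass_of_ergodicSMul (Γ := Γ) μ hμ
    set e := embeddingReal X
    have he : MeasurableEmbedding e := measurableEmbedding_embeddingReal X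
    obtain ⟨S, hS, hSm, hSinj⟩ := exists_conull_le_of_forall_smul_lt_imp_le (Γ := Γ) μ he
    let Φ : X → Γ → Γ → Bool := fun x => orbitRel e (π x).1 x
    have hΦm : Measurable Φ := measurable_orbitRel he (measurable_subtype_coe.comp hπm)
    have hΦγ : ∀ (γ : Γ) x, Φ (γ • x) = translateRel γ (Φ x) := fun γ x => by
      rw [← orbitRel_smul, show translateRel γ (π x).1 = (γ • π x).1 from rfl, ← hπ]
    have hΦt : ∀ᵐ x ∂μ, Φ x ∈ TotalOrders Γ := by
      -- Breaking ties at `x` uses the stabilizers along the whole orbit of `x`.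
      have : ∀ᵐ x ∂μ, ∀ g : Γ, PartialOrders.IsLeftInvariantTotal
          (PartialOrders.restrict (π (g • x)) (MulAction.stabilizer Γ (g • x))) :=
        ae_all_iff.2 fun g => (tendsto_smul_ae μ g).eventually hπs
      filter_upwards [this] with x hx
      exact orbitRel_mem_totalOrders he.injective (π x).2 fun a b hab h =>
        PartialOrders.total_of_isLeftInvariantTotal_restrict hπ (hx a⁻¹) hab h
    let G : Set X := Φ ⁻¹' TotalOrders Γ
    have hG : MeasurableSet G := hΦm (measurableSet_totalOrders Γ)
    let o : TotalOrders Γ := Classical.choice inferInstance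
    let φ : X → TotalOrders Γ := fun x => if h : x ∈ G then ⟨Φ x, h⟩ else o
    have hφval : ∀ x ∈ G, (φ x).1 = Φ x := fun x hx => by simp only [φ, dif_pos hx]
    have hφm : Measurable φ :=
      Measurable.dite (f := fun x : G => (⟨Φ x, x.2⟩ : TotalOrders Γ)) (g := fun _ => o)
        (hΦm.comp measurable_subtype_coe).subtype_mk measurable_const hG
    refine exists_isInvariantRandomOrder_of_injOn μ hφm (inter_mem hS hΦt) (hSm.inter hG) ?_
      fun γ => ?_
    · have key : ∀ x ∈ S ∩ G, ∀ y ∈ S ∩ G, φ x = φ y → e y ≤ e x := by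
        intro x hx y hy hxy
        have hΦ : Φ x = Φ y := by rw [← hφval x hx.2, ← hφval y hy.2, hxy]
        refine hSinj x hx.1 y hy.1 fun g hg => ?_
        -- Comparison with `1` tells which translates lie below the point itself; a tie at `x` still
        -- gives the weak inequality needed.
        have h : Φ y g 1 = true := orbitRel_eq_true_iff.2 (.inl (by simpa using hg))
        rw [← hΦ, orbitRel_eq_true_iff] at h
        rcases h with h | h
        · simpa using h.le
        · simpa using (congr_arg e h.1).le
      exact fun x hx y hy hxy => he.injective
        (le_antisymm (key y hy x hx hxy.symm) (key x hx y hy hxy))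
    · filter_upwards [hΦt] with x hx
      have hx' : γ • x ∈ G := by
        change Φ (γ • x) ∈ TotalOrders Γ
        rw [hΦγ]
        exact translateRel_mem_totalOrders γ hx
      refine Subtype.ext ?_
      rw [hφval _ hx', hΦγ]
      change _ = translateRel γ (φ x).1
      rw [hφval x hx]
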